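/- Let $n\ge 1$ and $m=2n$. The binary reflected Gray labels of $n$ bits are listed recursively: the list for $n$ bits is the list for $n-1$ bits with each label prefixed by $0$, followed by the reversed list for $n-1$ bits with each label prefixed by $1$. Map the labels, in this order, to the $2^n$-PAM amplitudes $-(2^n-1),-(2^n-3),\dots,2^n-1$, and let $\mu:\{0,1\}^m\to\mathbb{C}$ be the Cartesian product of two such mappings, one for the in-phase and one for the quadrature component (square $2^m$-QAM with binary reflected Gray mapping). Let $B_1,\dots,B_m$ be independent bits with arbitrary distributions $P_{B_1},\dots,P_{B_m}$, and let $$Y=\sqrt{\mathsf{snr}}\,X+Z,\qquad X=c\,(\mu(B_1,\dots,B_m)-a),$$ where $Z$ is zero-mean, unit-variance, circularly symmetric complex Gaussian noise independent of the bits, and $a\in\mathbb{C}$, $c>0$ are such that $\mathbb{E}[X]=0$ and $\mathbb{E}[|X|^2]=1$. The capacity of BICM with bit shaping (in nats) is $$C^{\rm bicm}(\mathsf{snr})=\sup_{P_{B_1},\dots,P_{B_m}}\ \sum_{j=1}^m I(B_j;Y),$$ the supremum being over all bit distributions for which such $a,c$ exist. **Theorem.** BICM with bit shaping over square QAM with binary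 reflected Gray mapping is first- and second-order optimal: $C^{\rm bicm}(\mathsf{snr})$ is finite for $\mathsf{snr}>0$ and $$C^{\rm bicm}(\mathsf{snr})=\mathsf{snr}-\tfrac12\,\mathsf{snr}^2+o(\mathsf{snr}^2)\qquad(\mathsf{snr}\downarrow 0),$$ i.e. $c_1=1$ and $c_2=-\tfrac12$. The same holds if the constellation is only scaled and not translated ($a=0$, so that $\mathbb{E}[X]=0$ constrains the bit distributions). Moreover, there are bit distributions, not depending on $\mathsf{snr}$, and a $c>0$ such that, with $a=0$, $X$ satisfies $\mathbb{E}[X]=0$ and $\mathbb{E}[|X|^2]=1$, is uniformly distributed on the QPSK constellation $\{(\pm1\pm i)/\sqrt2\}$, and $\sum_{j=1}^m I(B_j;Y)$ is finite for $\mathsf{snr}>0$ and has the same expansion. -/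

import Mathlib

open MeasureTheory ProbabilityTheory Filter Asymptotics Topology
open scoped ENNReal

/-- Mutual information (in nats) of a pair of random variables with joint law `ρ`: the
Kullback-Leibler divergence of the joint law from the product of its two marginals. -/
noncomputable def mutualInfo {α β : Type*} [MeasurableSpace α] [MeasurableSpace β]
    (ρ : Measure (α × β)) : ℝ≥0∞ :=
  InformationTheory.klDiv ρ (ρ.fst.prod ρ.snd)

/-- Law of a zero-mean, unit-variance, circularly symmetric complex Gaussian variable: the real and
imaginary parts are independent real Gaussians of mean `0` and variance `1/2`. -/
noncomputable def complexNoise : Measure ℂ :=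
  ((gaussianReal 0 (1 / 2)).prod (gaussianReal 0 (1 / 2))).map Complex.measurableEquivRealProd.symm

/-- Position (from `0` to `2 ^ n - 1`) of the label `b` in the list of binary reflected Gray labels
of `n` bits. The list for `n + 1` bits is the list for `n` bits prefixed with `0`, followed by the
reversed list for `n` bits prefixed with `1`, so `0 b'` stands at the position of `b'` and `1 b'`
at `2 ^ (n + 1) - 1` minus the position of `b'`. -/
def grayIndex : (n : ℕ) → (Fin n → Bool) → ℕ
  | 0, _ => 0
  | n + 1, b =>
      if b 0 then 2 ^ (n + 1) - 1 - grayIndex n (Fin.tail b) else grayIndex n (Fin.tail b)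

/-- Binary reflected Gray mapping of `n` bits onto the `2 ^ n`-PAM amplitudes
`-(2 ^ n - 1), -(2 ^ n - 3), …, 2 ^ n - 3, 2 ^ n - 1`. -/
noncomputable def pamPoint (n : ℕ) (b : Fin n → Bool) : ℝ :=
  2 * (grayIndex n b : ℝ) - ((2 : ℝ) ^ n - 1)

/-- Labels of `2 * n` bits: `Sum.inl` indexes the in-phase bits, `Sum.inr` the quadrature bits. -/
abbrev QAMLabel (n : ℕ) : Type := Fin n ⊕ Fin n → Bool

/-- Binary reflected Gray mapping onto square `2 ^ (2 * n)`-QAM: Cartesian product of the Gray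
mappings onto the in-phase and the quadrature `2 ^ n`-PAM. -/
noncomputable def qamPoint (n : ℕ) (b : QAMLabel n) : ℂ :=
  ⟨pamPoint n fun i => b (Sum.inl i), pamPoint n fun i => b (Sum.inr i)⟩

/-- The channel input carrying the label `b` when the QAM constellation is translated by `-a` and
scaled by `c`. -/
noncomputable def qamSymbol (n : ℕ) (a : ℂ) (c : ℝ) (b : QAMLabel n) : ℂ :=
  (c : ℂ) * (qamPoint n b - a)

/-- Law of the label: independent bits, the `j`-th one with distribution `p j`. -/
noncomputable def labelLaw (n : ℕ) (p : Fin n ⊕ Fin n → PMF Bool) : Measure (QAMLabel n) :=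
  Measure.pi fun j => (p j).toMeasure

/-- With bit distributions `p`, translation `a` and scaling `c > 0`, the channel input `X` satisfies
`E[X] = 0` and `E[|X|²] = 1`. -/
def IsNormalized (n : ℕ) (p : Fin n ⊕ Fin n → PMF Bool) (a : ℂ) (c : ℝ) : Prop :=
  0 < c ∧ ∫ b, qamSymbol n a c b ∂labelLaw n p = 0 ∧
    ∫ b, ‖qamSymbol n a c b‖ ^ 2 ∂labelLaw n p = 1

/-- Joint law of the `j`-th bit `B_j` and the output `Y = √snr X + Z`, where `X` is the channel
input carrying the label `B`, and the noise `Z` is independent of `B`. -/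
noncomputable def bitOutputLaw (n : ℕ) (p : Fin n ⊕ Fin n → PMF Bool) (a : ℂ) (c snr : ℝ)
    (j : Fin n ⊕ Fin n) : Measure (Bool × ℂ) :=
  ((labelLaw n p).prod complexNoise).map
    fun ω => (ω.1 j, (Real.sqrt snr : ℂ) * qamSymbol n a c ω.1 + ω.2)

/-- Rate of BICM for the given bit distributions: the sum over `j` of `I(B_j; Y)`. -/
noncomputable def bicmRate (n : ℕ) (p : Fin n ⊕ Fin n → PMF Bool) (a : ℂ) (c snr : ℝ) : ℝ≥0∞ :=
  ∑ j, mutualInfo (bitOutputLaw n p a c snr j)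

/-- Capacity of BICM with bit shaping: the supremum of the rate over all bit distributions, the
QAM constellation being normalized in mean and energy by a translation and a scaling. -/
noncomputable def bicmCapacity (n : ℕ) (snr : ℝ) : ℝ≥0∞ :=
  ⨆ (p : Fin n ⊕ Fin n → PMF Bool) (a : ℂ) (c : ℝ) (_ : IsNormalized n p a c),
    bicmRate n p a c snr

/-- The same, for the QAM constellation that is only scaled: `E[X] = 0` then is a constraint on the
bit distributions. -/
noncomputable def bicmCapacityCentered (n : ℕ) (snr : ℝ) : ℝ≥0∞ :=
  ⨆ (p : Fin n ⊕ Fin n → PMF Bool) (c : ℝ) (_ : IsNormalized n p 0 c), bicmRate n p 0 c snr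

/-- The rate `R` is finite and `R snr = c₁ snr + c₂ snr² + o(snr²)` as `snr` decreases to `0`. -/
def HasLowSNRExpansion (R : ℝ → ℝ≥0∞) (c₁ c₂ : ℝ) : Prop :=
  (∀ snr : ℝ, 0 < snr → R snr ≠ ∞) ∧
    (fun snr : ℝ => (R snr).toReal - (c₁ * snr + c₂ * snr ^ 2)) =o[𝓝[>] 0] fun snr => snr ^ 2

/-- The four points `(±1 ± i) / √2`. -/
def qpsk : Set ℂ := {z | |z.re| = 1 / Real.sqrt 2 ∧ |z.im| = 1 / Real.sqrt 2}

-- All three rates are squeezed between bounds that agree with `snr - snr²/2` up to `O(snr³)`.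
--
-- Upper bound, uniform over bit distributions: for independent bits `∑ I(B_j; Y) ≤ I(B; Y)`, and
-- `I(B; Y)` is at most the divergence relative to any reference output law `g`. `sum_mutualInfo_le`
-- obtains both inequalities in one Jensen step: for almost every `y` the ratios `P(b_j | y) /
-- P(b_j)` average to 1 over the prior, so by independence their product times `g / q` integrates to
-- 1 under the joint law. A Gaussian `g` with the energy of the output gives `log (1 + snr)`
-- (`bicmRate_le_log`).
--
-- Lower bound: with all other bits of a Gray label equal to 0, the leading bit switches between the
-- two extreme amplitudes. Uniform leading bits and frozen other bits therefore produce QPSK, that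
-- is, two antipodal channels of energy `snr / 2`. Each is estimated by the Donsker-Varadhan bound
-- `ofReal_integral_le_klDiv`, tested on the log-likelihood ratio with `log cosh` replaced by a
-- polynomial majorant (`cosh_le_exp_sextic`), so that Gaussian moments suffice
-- (`exists_le_integral_antipodalTest`). This input does not depend on `snr` and has `a = 0`, so it
-- serves both suprema and the explicit claim.

open scoped NNReal

-- Relative entropy: variational lower bound and finiteness.

section General

variable {α : Type*} [MeasurableSpace α]

/-- Integrate `F + 1 ≤ exp F`. Both the Donsker-Varadhan bound and the bound on the sum of mutual
informations reduce to this. -/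
lemma integral_nonpos_of_lintegral_exp_le_one {μ : Measure α} [IsProbabilityMeasure μ]
    {F : α → ℝ} (hF : Integrable F μ) (h : ∫⁻ x, ENNReal.ofReal (Real.exp (F x)) ∂μ ≤ 1) :
    ∫ x, F x ∂μ ≤ 0 := by
  have hm : AEStronglyMeasurable (fun x => Real.exp (F x)) μ :=
    Real.continuous_exp.comp_aestronglyMeasurable hF.1
  have hi : Integrable (fun x => Real.exp (F x)) μ := by
    refine ⟨hm, ?_⟩
    rw [hasFiniteIntegral_iff_ofReal (ae_of_all _ fun x => (Real.exp_pos _).le)]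
    exact h.trans_lt ENNReal.one_lt_top
  have h1 : ∫ x, Real.exp (F x) ∂μ ≤ 1 := by
    rw [integral_eq_lintegral_of_nonneg_ae (ae_of_all _ fun x => (Real.exp_pos _).le) hm]
    exact ENNReal.toReal_le_of_le_ofReal zero_le_one (by simpa using h)
  have h2 : ∫ x, F x ∂μ ≤ ∫ x, (Real.exp (F x) - 1) ∂μ :=
    integral_mono hF (hi.sub (integrable_const _)) fun x => by
      have := Real.add_one_le_exp (F x)
      simp only
      linarith
  rw [integral_sub hi (integrable_const _)] at h2
  simp only [integral_const, probReal_univ, smul_eq_mul, mul_one] at h2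
  linarith

/-- Donsker-Varadhan lower bound. -/
lemma ofReal_integral_le_klDiv {ρ π : Measure α} [IsProbabilityMeasure ρ] [IsProbabilityMeasure π]
    {f : α → ℝ} (hf : Integrable f ρ) (hfm : Measurable f)
    (h : ∫⁻ x, ENNReal.ofReal (Real.exp (f x)) ∂π ≤ 1) :
    ENNReal.ofReal (∫ x, f x ∂ρ) ≤ InformationTheory.klDiv ρ π := by
  by_cases htop : InformationTheory.klDiv ρ π = ∞
  · simp [htop]
  obtain ⟨hac, hint⟩ := InformationTheory.klDiv_ne_top_iff.mp htop
  refine ENNReal.ofReal_le_of_le_toReal ?_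
  rw [InformationTheory.toReal_klDiv_of_measure_eq hac (by simp), ← sub_nonpos,
    ← integral_sub hf hint]
  -- Under `ρ`, `exp (f - llr)` is `exp f` divided by the density of `ρ`. Passing to `π` cancels the
  -- density where it is positive and leaves 0 where it vanishes, hence only an inequality.
  refine integral_nonpos_of_lintegral_exp_le_one (hf.sub hint) (le_trans ?_ h)
  have hrn : Measurable (ρ.rnDeriv π) := Measure.measurable_rnDeriv _ _
  have hpos := Measure.rnDeriv_pos hac
  have hlt := hac.ae_le (Measure.rnDeriv_lt_top ρ π)
  calc ∫⁻ x, ENNReal.ofReal (Real.exp (f x - llr ρ π x)) ∂ρ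
      = ∫⁻ x, (ρ.rnDeriv π x)⁻¹ * ENNReal.ofReal (Real.exp (f x)) ∂ρ := by
        refine lintegral_congr_ae ?_
        filter_upwards [hpos, hlt] with x hx hx'
        have h0 : 0 < (ρ.rnDeriv π x).toReal := ENNReal.toReal_pos hx.ne' hx'.ne
        rw [llr_def, sub_eq_add_neg, Real.exp_add, Real.exp_neg, Real.exp_log h0, mul_comm,
          ENNReal.ofReal_mul (inv_nonneg.2 h0.le), ENNReal.ofReal_inv_of_pos h0,
          ENNReal.ofReal_toReal hx'.ne]
    _ = ∫⁻ x, (ρ.rnDeriv π x)⁻¹ * ENNReal.ofReal (Real.exp (f x)) ∂(π.withDensity (ρ.rnDeriv π)) := by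
        rw [Measure.withDensity_rnDeriv_eq _ _ hac]
    _ = ∫⁻ x, ρ.rnDeriv π x * ((ρ.rnDeriv π x)⁻¹ * ENNReal.ofReal (Real.exp (f x))) ∂π := by
        rw [lintegral_withDensity_eq_lintegral_mul _ hrn (by fun_prop)]
        rfl
    _ ≤ ∫⁻ x, ENNReal.ofReal (Real.exp (f x)) ∂π := by
        refine lintegral_mono fun x => ?_
        rw [← mul_assoc]
        exact mul_le_of_le_one_left' (ENNReal.mul_inv_le_one _)

/-- The density is bounded by `C` almost everywhere, and the continuous `klFun` is bounded on `[0,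
C]`. -/
lemma klDiv_ne_top_of_le_smul {ρ π : Measure α} [IsFiniteMeasure ρ] [IsFiniteMeasure π]
    {C : ℝ≥0∞} (hC : C ≠ ∞) (h : ρ ≤ C • π) : InformationTheory.klDiv ρ π ≠ ∞ := by
  have hac : ρ ≪ π := (Measure.absolutelyContinuous_of_le h).trans
    (Measure.smul_absolutelyContinuous)
  refine InformationTheory.klDiv_ne_top hac ?_
  rw [← InformationTheory.integrable_klFun_rnDeriv_iff hac]
  have hbd : ∀ᵐ x ∂π, ρ.rnDeriv π x ≤ C := by
    refine ae_le_of_forall_setLIntegral_le_of_sigmaFinite (Measure.measurable_rnDeriv _ _) ?_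
    intro s hs _
    rw [Measure.setLIntegral_rnDeriv hac]
    simpa using h s
  obtain ⟨K, hK⟩ := (isCompact_Icc (a := (0:ℝ)) (b := C.toReal)).exists_bound_of_continuousOn
    (InformationTheory.continuous_klFun.continuousOn)
  refine Integrable.of_bound (C := K) ?_ ?_
  · exact (InformationTheory.continuous_klFun.measurable.comp
      (Measure.measurable_rnDeriv _ _).ennreal_toReal).aestronglyMeasurable
  · filter_upwards [hbd] with x hx
    exact hK _ ⟨ENNReal.toReal_nonneg, ENNReal.toReal_mono hC hx⟩

end General

-- Mutual information of one bit and an arbitrary output.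

section BoolInput

variable {β : Type*} [MeasurableSpace β]

/-- On the slice over `x`, the joint law is at most the output marginal, which is the product law
divided by the mass of `x`. The sum of the inverse masses is a common constant. -/
lemma exists_le_smul_prod_marginals (ρ : Measure (Bool × β)) [IsProbabilityMeasure ρ] :
    ∃ C : ℝ≥0∞, C ≠ ∞ ∧ ρ ≤ C • ρ.fst.prod ρ.snd := by
  classical
  -- Null atoms get weight 0 instead of `0⁻¹ = ∞`, which keeps the constant finite; the joint law
  -- vanishes on their slices.
  set c : Bool → ℝ≥0∞ := fun x => if ρ.fst {x} = 0 then 0 else (ρ.fst {x})⁻¹ with hc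
  refine ⟨∑ x, c x, ?_, ?_⟩
  · refine ENNReal.sum_ne_top.2 fun x _ => ?_
    by_cases h : ρ.fst {x} = 0 <;> simp [hc, h]
  refine Measure.le_intro fun s hs _ => ?_
  have hdec : ∀ μ : Measure (Bool × β), μ s = ∑ x : Bool, μ ({x} ×ˢ (Prod.mk x ⁻¹' s)) := by
    intro μ
    rw [← measure_biUnion_finset]
    · congr 1
      ext ⟨x, y⟩
      simp
    · intro x _ y _ hxy
      exact Set.disjoint_left.2 fun z hz hz' => hxy (by
        rw [← (Set.mem_prod.1 hz).1, ← (Set.mem_prod.1 hz').1])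
    · exact fun x _ => (measurableSet_singleton x).prod (measurable_prodMk_left hs)
  rw [hdec ρ, hdec (_ • _)]
  refine Finset.sum_le_sum fun x _ => ?_
  have hms : MeasurableSet (Prod.mk x ⁻¹' s) := measurable_prodMk_left hs
  have hle1 : ρ ({x} ×ˢ (Prod.mk x ⁻¹' s)) ≤ ρ.fst {x} := by
    rw [Measure.fst_apply (measurableSet_singleton x)]
    exact measure_mono fun z hz => (Set.mem_prod.1 hz).1
  have hle2 : ρ ({x} ×ˢ (Prod.mk x ⁻¹' s)) ≤ ρ.snd (Prod.mk x ⁻¹' s) := by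
    rw [Measure.snd_apply hms]
    exact measure_mono fun z hz => (Set.mem_prod.1 hz).2
  by_cases h : ρ.fst {x} = 0
  · exact (hle1.trans_eq h).trans (by simp)
  rw [Measure.smul_apply, Measure.prod_prod, smul_eq_mul, ← mul_assoc]
  refine hle2.trans (le_mul_of_one_le_left' ?_)
  calc (1 : ℝ≥0∞) = c x * ρ.fst {x} := by
        simp only [hc, h, if_false]
        rw [ENNReal.inv_mul_cancel h (measure_ne_top _ _)]
    _ ≤ _ := by gcongr; exact Finset.single_le_sum (fun _ _ => zero_le) (Finset.mem_univ x)

lemma absolutelyContinuous_prod_marginals (ρ : Measure (Bool × β)) [IsProbabilityMeasure ρ] :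
    ρ ≪ ρ.fst.prod ρ.snd := by
  obtain ⟨C, -, h⟩ := exists_le_smul_prod_marginals ρ
  exact (Measure.absolutelyContinuous_of_le h).trans Measure.smul_absolutelyContinuous

lemma mutualInfo_ne_top (ρ : Measure (Bool × β)) [IsProbabilityMeasure ρ] :
    mutualInfo ρ ≠ ∞ := by
  obtain ⟨C, hC, h⟩ := exists_le_smul_prod_marginals ρ
  exact klDiv_ne_top_of_le_smul hC h

/-- The density is `P(x | y) / P(x)`, so averaging over the prior sums the posterior. Formally, both
sides have the same integral over every output set `s`, namely the mass of `univ ×ˢ s`. -/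
lemma lintegral_rnDeriv_prod_marginals_eq_one (ρ : Measure (Bool × β)) [IsProbabilityMeasure ρ] :
    ∀ᵐ y ∂ρ.snd, ∫⁻ x, ρ.rnDeriv (ρ.fst.prod ρ.snd) (x, y) ∂ρ.fst = 1 := by
  have hm : Measurable (ρ.rnDeriv (ρ.fst.prod ρ.snd)) := Measure.measurable_rnDeriv _ _
  refine ae_eq_of_forall_setLIntegral_eq_of_sigmaFinite (hm.lintegral_prod_left')
    measurable_const ?_
  intro s hs _
  have h1 : ∫⁻ z in Set.univ ×ˢ s, ρ.rnDeriv (ρ.fst.prod ρ.snd) z ∂(ρ.fst.prod ρ.snd)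
      = ρ (Set.univ ×ˢ s) :=
    Measure.setLIntegral_rnDeriv (absolutelyContinuous_prod_marginals ρ) _
  rw [← Measure.prod_restrict, Measure.restrict_univ, lintegral_prod_symm _ hm.aemeasurable] at h1
  rw [h1]
  rw [setLIntegral_one, Measure.snd_apply hs, Set.univ_prod]

end BoolInput

lemma lintegral_pi_prod_eq {ι : Type*} [Fintype ι] (p : ι → Measure Bool)
    [∀ j, IsProbabilityMeasure (p j)] (f : ι → Bool → ℝ≥0∞) :
    ∫⁻ b, ∏ j, f j (b j) ∂Measure.pi p = ∏ j, ∫⁻ x, f j x ∂p j := by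
  classical
  simp_rw [lintegral_fintype, Measure.pi_singleton, ← Finset.prod_mul_distrib]
  rw [Finset.prod_univ_sum, Fintype.piFinset_univ]

lemma integrable_llr_of_bool {β : Type*} [MeasurableSpace β] (ρ : Measure (Bool × β))
    [IsProbabilityMeasure ρ] : Integrable (llr ρ (ρ.fst.prod ρ.snd)) ρ :=
  (InformationTheory.klDiv_ne_top_iff.mp (mutualInfo_ne_top ρ)).2

lemma toReal_mutualInfo {β : Type*} [MeasurableSpace β] (ρ : Measure (Bool × β))
    [IsProbabilityMeasure ρ] :
    (mutualInfo ρ).toReal = ∫ x, llr ρ (ρ.fst.prod ρ.snd) x ∂ρ :=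
  InformationTheory.toReal_klDiv_of_measure_eq (absolutelyContinuous_prod_marginals ρ) (by simp)

-- Sum of mutual informations of independent bits.

section IndependentBits

variable {ι : Type*} [Fintype ι] {β : Type*} [MeasurableSpace β]

/-- For independent bits `B_j`, and an output with conditional densities `q b`, the sum of the
mutual informations `I(B_j; Y)` is at most the divergence of the joint law of the bits and the output
from the product of the law of the bits and any law with a positive density `g`. -/
theorem sum_mutualInfo_le (p : ι → PMF Bool) (ν : Measure β) [SigmaFinite ν]
    {q : (ι → Bool) → β → ℝ} (hqm : Measurable fun ω : (ι → Bool) × β => q ω.1 ω.2)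
    (hqpos : ∀ b y, 0 < q b y) (hq : ∀ b, ∫⁻ y, ENNReal.ofReal (q b y) ∂ν = 1)
    {g : β → ℝ} (hgm : Measurable g) (hgpos : ∀ y, 0 < g y)
    (hg : ∫⁻ y, ENNReal.ofReal (g y) ∂ν = 1) {M : Measure ((ι → Bool) × β)}
    (hM : M = ((Measure.pi fun j => (p j).toMeasure).prod ν).withDensity
      fun ω => ENNReal.ofReal (q ω.1 ω.2))
    (hint : Integrable (fun ω => Real.log (q ω.1 ω.2 / g ω.2)) M) :
    ∑ j, mutualInfo (M.map fun ω => (ω.1 j, ω.2)) ≤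
      ENNReal.ofReal (∫ ω, Real.log (q ω.1 ω.2 / g ω.2) ∂M) := by
  classical
  set W : Measure (ι → Bool) := Measure.pi fun j => (p j).toMeasure with hW
  have hqm' : Measurable fun ω : (ι → Bool) × β => ENNReal.ofReal (q ω.1 ω.2) := hqm.ennreal_ofReal
  have hfst : M.map Prod.fst = W := by
    ext s hs
    rw [Measure.map_apply measurable_fst hs, hM, withDensity_apply _ (measurable_fst hs),
      ← Set.prod_univ, ← Measure.prod_restrict, Measure.restrict_univ,
      lintegral_prod _ hqm'.aemeasurable]
    simp [hq]
  have : IsProbabilityMeasure M := by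
    constructor
    have : IsProbabilityMeasure (M.map Prod.fst) := by rw [hfst]; infer_instance
    have h := this.measure_univ
    rwa [Measure.map_apply measurable_fst MeasurableSet.univ, Set.preimage_univ] at h
  have hT : ∀ j, Measurable fun ω : (ι → Bool) × β => (ω.1 j, ω.2) := fun j =>
    ((measurable_pi_apply j).comp measurable_fst).prodMk measurable_snd
  set ρ : ι → Measure (Bool × β) := fun j => M.map fun ω => (ω.1 j, ω.2) with hρ
  have hρp : ∀ j, IsProbabilityMeasure (ρ j) := fun j =>
    Measure.isProbabilityMeasure_map (hT j).aemeasurable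
  have hρfst : ∀ j, (ρ j).fst = (p j).toMeasure := by
    intro j
    have h1 : (ρ j).fst = (M.map Prod.fst).map (Function.eval j) := by
      rw [Measure.fst, hρ, Measure.map_map measurable_fst (hT j),
        Measure.map_map (measurable_pi_apply j) measurable_fst]
      rfl
    rw [h1, hfst, hW, Measure.pi_map_eval, Finset.prod_eq_one fun i _ => measure_univ, one_smul]
  -- Positivity of `q` makes `ν` absolutely continuous with respect to the output law, so the
  -- normalization of the ratios, known almost everywhere for the latter, also holds `ν`-almost
  -- everywhere.
  have hρsnd : ∀ j, ν ≪ (ρ j).snd := by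
    intro j
    refine Measure.AbsolutelyContinuous.mk fun s hs h0 => ?_
    rw [Measure.snd_apply hs, hρ, Measure.map_apply (hT j) (measurable_snd hs)] at h0
    have hac : W.prod ν ≪ M := by
      rw [hM]
      exact withDensity_absolutelyContinuous' hqm'.aemeasurable
        (ae_of_all _ fun ω => (ENNReal.ofReal_pos.2 (hqpos _ _)).ne')
    have h1 := hac h0
    have h2 : (fun ω : (ι → Bool) × β => (ω.1 j, ω.2)) ⁻¹' (Prod.snd ⁻¹' s)
        = Set.univ ×ˢ s := by
      ext ω; simp
    rw [h2, Measure.prod_prod] at h1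
    simpa using h1
  set R : ι → Bool × β → ℝ≥0∞ := fun j => (ρ j).rnDeriv ((ρ j).fst.prod (ρ j).snd) with hR
  have hRm : ∀ j, Measurable (R j) := fun j => Measure.measurable_rnDeriv _ _
  have hllr : ∀ j, Integrable (fun ω : (ι → Bool) × β =>
      llr (ρ j) ((ρ j).fst.prod (ρ j).snd) (ω.1 j, ω.2)) M := fun j =>
    (integrable_llr_of_bool (ρ j)).comp_measurable (hT j)
  have hval : ∀ j, mutualInfo (ρ j) = ENNReal.ofReal
      (∫ ω, llr (ρ j) ((ρ j).fst.prod (ρ j).snd) (ω.1 j, ω.2) ∂M) := by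
    intro j
    rw [← ENNReal.ofReal_toReal (mutualInfo_ne_top (ρ j)), toReal_mutualInfo]
    congr 1
    exact integral_map (hT j).aemeasurable (stronglyMeasurable_llr _ _).aestronglyMeasurable
  have hnn : ∀ j, 0 ≤ ∫ ω, llr (ρ j) ((ρ j).fst.prod (ρ j).snd) (ω.1 j, ω.2) ∂M := by
    intro j
    have h : ∫ ω, llr (ρ j) ((ρ j).fst.prod (ρ j).snd) (ω.1 j, ω.2) ∂M
        = ∫ x, llr (ρ j) ((ρ j).fst.prod (ρ j).snd) x ∂(ρ j) :=
      (integral_map (hT j).aemeasurable (stronglyMeasurable_llr _ _).aestronglyMeasurable).symm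
    rw [h, ← toReal_mutualInfo]
    exact ENNReal.toReal_nonneg
  rw [Finset.sum_congr rfl fun j _ => hval j, ← ENNReal.ofReal_sum_of_nonneg fun j _ => hnn j]
  refine ENNReal.ofReal_le_ofReal ?_
  rw [← integral_finsetSum _ fun j _ => hllr j, ← sub_nonpos,
    ← integral_sub (integrable_finsetSum _ fun j _ => hllr j) hint]
  refine integral_nonpos_of_lintegral_exp_le_one
    ((integrable_finsetSum _ fun j _ => hllr j).sub hint) ?_
  have hRpos : ∀ᵐ ω ∂M, ∀ j, 0 < R j (ω.1 j, ω.2) ∧ R j (ω.1 j, ω.2) < ∞ := by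
    refine ae_all_iff.2 fun j => ?_
    have hac := absolutelyContinuous_prod_marginals (ρ j)
    refine ae_of_ae_map (f := fun ω : (ι → Bool) × β => (ω.1 j, ω.2))
      (p := fun z => 0 < R j z ∧ R j z < ∞) (hT j).aemeasurable ?_
    exact (Measure.rnDeriv_pos hac).and (hac.ae_le (Measure.rnDeriv_lt_top _ _))
  have hprodm : Measurable fun ω : (ι → Bool) × β => ∏ j, R j (ω.1 j, ω.2) :=
    Finset.measurable_prod _ fun j _ => (hRm j).comp (hT j)
  refine le_of_eq ?_
  -- The density `q` of `M` cancels the denominator of `g / q`. For fixed `y` the integral over the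
  -- bits then factorizes into integrals equal to 1, and only the mass of `g` remains.
  calc ∫⁻ ω, ENNReal.ofReal (Real.exp (∑ j, llr (ρ j) ((ρ j).fst.prod (ρ j).snd) (ω.1 j, ω.2)
          - Real.log (q ω.1 ω.2 / g ω.2))) ∂M
      = ∫⁻ ω, (∏ j, R j (ω.1 j, ω.2)) * ENNReal.ofReal (g ω.2 / q ω.1 ω.2) ∂M := by
        refine lintegral_congr_ae ?_
        filter_upwards [hRpos] with ω hω
        have h0 : ∀ j, 0 < (R j (ω.1 j, ω.2)).toReal := fun j =>
          ENNReal.toReal_pos (hω j).1.ne' (hω j).2.ne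
        rw [sub_eq_add_neg, Real.exp_add, ← Real.log_inv, inv_div,
          Real.exp_log (div_pos (hgpos _) (hqpos _ _)), Real.exp_sum,
          ENNReal.ofReal_mul (Finset.prod_nonneg fun j _ => (Real.exp_pos _).le),
          ENNReal.ofReal_prod_of_nonneg fun j _ => (Real.exp_pos _).le]
        congr 1
        refine Finset.prod_congr rfl fun j _ => ?_
        rw [llr_def]
        change ENNReal.ofReal (Real.exp (Real.log (R j (ω.1 j, ω.2)).toReal)) = _
        rw [Real.exp_log (h0 j), ENNReal.ofReal_toReal (hω j).2.ne]
    _ = ∫⁻ ω, (∏ j, R j (ω.1 j, ω.2)) * ENNReal.ofReal (g ω.2) ∂(W.prod ν) := by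
        have hmeas : Measurable fun ω : (ι → Bool) × β =>
            (∏ j, R j (ω.1 j, ω.2)) * ENNReal.ofReal (g ω.2 / q ω.1 ω.2) :=
          hprodm.mul ((hgm.comp measurable_snd).div hqm).ennreal_ofReal
        rw [hM, lintegral_withDensity_eq_lintegral_mul _ hqm' hmeas]
        refine lintegral_congr fun ω => ?_
        rw [Pi.mul_apply, mul_left_comm, ← ENNReal.ofReal_mul (hqpos _ _).le,
          mul_div_cancel₀ _ (hqpos _ _).ne']
    _ = ∫⁻ y, (∏ j, ∫⁻ x, R j (x, y) ∂(p j).toMeasure) * ENNReal.ofReal (g y) ∂ν := by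
        have hmeas : Measurable fun ω : (ι → Bool) × β =>
            (∏ j, R j (ω.1 j, ω.2)) * ENNReal.ofReal (g ω.2) :=
          hprodm.mul (hgm.comp measurable_snd).ennreal_ofReal
        rw [lintegral_prod_symm _ hmeas.aemeasurable]
        refine lintegral_congr fun y => ?_
        rw [lintegral_mul_const (ENNReal.ofReal (g y)) (measurable_of_finite
          fun b : ι → Bool => ∏ j, R j (b j, y)), ←
          lintegral_pi_prod_eq (fun j => (p j).toMeasure) (fun j x => R j (x, y))]
    _ = ∫⁻ y, ENNReal.ofReal (g y) ∂ν := by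
        refine lintegral_congr_ae ?_
        have h : ∀ᵐ y ∂ν, ∀ j, ∫⁻ x, R j (x, y) ∂(p j).toMeasure = 1 := by
          refine ae_all_iff.2 fun j => (hρsnd j).ae_le ?_
          rw [← hρfst j]
          exact lintegral_rnDeriv_prod_marginals_eq_one (ρ j)
        filter_upwards [h] with y hy
        simp [hy]
    _ = 1 := hg

end IndependentBits

-- Complex Gaussian densities and moments.

/-- Density of the circularly symmetric complex Gaussian law with mean `m` and variance `v` per real
dimension. -/
noncomputable def complexGaussianPDF (m : ℂ) (v : ℝ≥0) (z : ℂ) : ℝ :=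
  gaussianPDFReal m.re v z.re * gaussianPDFReal m.im v z.im

lemma complexGaussianPDF_pos (m : ℂ) {v : ℝ≥0} (hv : v ≠ 0) (z : ℂ) :
    0 < complexGaussianPDF m v z :=
  mul_pos (gaussianPDFReal_pos _ _ _ hv) (gaussianPDFReal_pos _ _ _ hv)

lemma measurable_complexGaussianPDF (m : ℂ) (v : ℝ≥0) : Measurable (complexGaussianPDF m v) :=
  ((measurable_gaussianPDFReal _ _).comp Complex.measurable_re).mul
    ((measurable_gaussianPDFReal _ _).comp Complex.measurable_im)

lemma map_gaussianReal_prod (m : ℂ) {v : ℝ≥0} (hv : v ≠ 0) :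
    ((gaussianReal m.re v).prod (gaussianReal m.im v)).map Complex.measurableEquivRealProd.symm
      = volume.withDensity fun z => ENNReal.ofReal (complexGaussianPDF m v z) := by
  rw [gaussianReal_of_var_ne_zero _ hv, gaussianReal_of_var_ne_zero _ hv,
    prod_withDensity (measurable_gaussianPDF _ _) (measurable_gaussianPDF _ _)]
  have hm : Measurable fun z => ENNReal.ofReal (complexGaussianPDF m v z) :=
    (measurable_complexGaussianPDF m v).ennreal_ofReal
  ext s hs
  have hs' : MeasurableSet (Complex.measurableEquivRealProd.symm ⁻¹' s) :=
    Complex.measurableEquivRealProd.symm.measurable hs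
  rw [Measure.map_apply Complex.measurableEquivRealProd.symm.measurable hs,
    withDensity_apply _ hs', withDensity_apply _ hs,
    ← Complex.volume_preserving_equiv_real_prod.symm.setLIntegral_comp_preimage hs hm,
    Measure.volume_eq_prod]
  refine lintegral_congr fun x => ?_
  rw [complexGaussianPDF, ENNReal.ofReal_mul (gaussianPDFReal_nonneg _ _ _)]
  rfl

lemma lintegral_complexGaussianPDF (m : ℂ) {v : ℝ≥0} (hv : v ≠ 0) :
    ∫⁻ z, ENNReal.ofReal (complexGaussianPDF m v z) = 1 := by
  have h : IsProbabilityMeasure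
      (((gaussianReal m.re v).prod (gaussianReal m.im v)).map Complex.measurableEquivRealProd.symm) :=
    Measure.isProbabilityMeasure_map Complex.measurableEquivRealProd.symm.measurable.aemeasurable
  rw [map_gaussianReal_prod m hv] at h
  have h1 := h.measure_univ
  rwa [withDensity_apply _ MeasurableSet.univ, Measure.restrict_univ] at h1

instance : IsProbabilityMeasure complexNoise :=
  Measure.isProbabilityMeasure_map Complex.measurableEquivRealProd.symm.measurable.aemeasurable

lemma complexNoise_map_const_add (x : ℂ) :
    complexNoise.map (fun z => x + z)
      = volume.withDensity fun z => ENNReal.ofReal (complexGaussianPDF x (1 / 2) z) := by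
  rw [← map_gaussianReal_prod x (by norm_num), complexNoise]
  have h1 := gaussianReal_map_const_add (μ := 0) (v := 1 / 2) x.re
  have h2 := gaussianReal_map_const_add (μ := 0) (v := 1 / 2) x.im
  rw [zero_add] at h1 h2
  rw [← h1, ← h2, Measure.map_prod_map _ _ (by fun_prop) (by fun_prop),
    Measure.map_map (by fun_prop) Complex.measurableEquivRealProd.symm.measurable,
    Measure.map_map Complex.measurableEquivRealProd.symm.measurable (by fun_prop)]
  congr 1

lemma complexNoise_map_re : complexNoise.map Complex.re = gaussianReal 0 (1 / 2) := by
  rw [complexNoise, Measure.map_map Complex.measurable_re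
    Complex.measurableEquivRealProd.symm.measurable]
  exact Measure.map_fst_prod.trans (by simp)

lemma complexNoise_map_im : complexNoise.map Complex.im = gaussianReal 0 (1 / 2) := by
  rw [complexNoise, Measure.map_map Complex.measurable_im
    Complex.measurableEquivRealProd.symm.measurable]
  exact Measure.map_snd_prod.trans (by simp)

lemma integrable_pow_gaussianReal (m : ℝ) (v : ℝ≥0) (k : ℕ) :
    Integrable (fun x => x ^ k) (gaussianReal m v) := by
  have h := (memLp_id_gaussianReal (μ := m) (v := v) k).integrable_norm_pow'
  simp only [id, ← norm_pow] at h
  exact (integrable_norm_iff (by fun_prop)).1 h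

/-- The moments are the derivatives at 0 of the moment generating function `exp (v t² / 2)`; each
derivative is a polynomial times this exponential, updated by `hstep`. -/
lemma integral_pow_gaussianReal_zero (v : ℝ≥0) :
    ∫ x, x ∂gaussianReal 0 v = 0 ∧ ∫ x, x ^ 2 ∂gaussianReal 0 v = v ∧
      ∫ x, x ^ 3 ∂gaussianReal 0 v = 0 ∧ ∫ x, x ^ 4 ∂gaussianReal 0 v = 3 * (v : ℝ) ^ 2 := by
  have key : ∀ k : ℕ, ∫ x, x ^ k ∂gaussianReal 0 v
      = iteratedDeriv k (fun t => Real.exp (v * t ^ 2 / 2)) 0 := by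
    intro k
    have h := iteratedDeriv_mgf_zero (X := id) (μ := gaussianReal 0 v) (by simp) k
    rw [mgf_id_gaussianReal] at h
    simpa using h.symm
  have he : ∀ t : ℝ, HasDerivAt (fun t : ℝ => Real.exp (v * t ^ 2 / 2))
      (v * t * Real.exp (v * t ^ 2 / 2)) t := by
    intro t
    have h := ((((hasDerivAt_id t).pow 2).const_mul (v : ℝ)).div_const 2).exp
    refine h.congr_deriv ?_
    simp
    ring
  have hstep : ∀ {P P' : ℝ → ℝ}, (∀ t, HasDerivAt P (P' t) t) →
      deriv (fun t => P t * Real.exp (v * t ^ 2 / 2))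
        = fun t => (P' t + v * t * P t) * Real.exp (v * t ^ 2 / 2) := by
    intro P P' hP
    funext t
    exact ((hP t).mul (he t)).deriv.trans (by ring)
  have h1 : deriv (fun t : ℝ => Real.exp (v * t ^ 2 / 2))
      = fun t => v * t * Real.exp (v * t ^ 2 / 2) := funext fun t => (he t).deriv
  have h2 := hstep (P := fun t => v * t) (P' := fun _ => v) fun t => by
    simpa using (hasDerivAt_id t).const_mul (v : ℝ)
  have h3 := hstep (P := fun t => v + v * t * (v * t)) (P' := fun t => 2 * v ^ 2 * t) fun t => by
    have h := ((hasDerivAt_id t).const_mul (v : ℝ))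
    refine ((h.mul h).const_add (v : ℝ)).congr_deriv ?_
    simp
    ring
  have h4 := hstep (P := fun t => 2 * v ^ 2 * t + v * t * (v + v * t * (v * t)))
    (P' := fun t => 3 * v ^ 2 + 3 * v ^ 3 * t ^ 2) fun t => by
    have h := ((hasDerivAt_id t).const_mul (v : ℝ))
    have h' := (hasDerivAt_id t).const_mul (2 * (v : ℝ) ^ 2)
    refine (h'.add (h.mul ((h.mul h).const_add (v : ℝ)))).congr_deriv ?_
    simp
    ring
  refine ⟨?_, ?_, ?_, ?_⟩
  · simp
  · rw [key 2]
    simp only [iteratedDeriv_succ, iteratedDeriv_zero, h1, h2]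
    simp
  · rw [key 3]
    simp only [iteratedDeriv_succ, iteratedDeriv_zero, h1, h2, h3]
    simp
  · rw [key 4]
    simp only [iteratedDeriv_succ, iteratedDeriv_zero, h1, h2, h3, h4]
    simp

lemma integrable_prod_of_finite {α β : Type*} [MeasurableSpace α] [MeasurableSpace β] [Finite α]
    [MeasurableSingletonClass α] {μ : Measure α} [IsFiniteMeasure μ] {ν : Measure β} [SFinite ν]
    {f : α × β → ℝ} (hf : AEStronglyMeasurable f (μ.prod ν))
    (h : ∀ a, Integrable (fun b => f (a, b)) ν) : Integrable f (μ.prod ν) :=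
  (integrable_prod_iff hf).2 ⟨ae_of_all _ h, Integrable.of_finite⟩

/-- The joint law of a discrete label and the output of a Gaussian channel has a Gaussian
conditional density. -/
lemma prod_complexNoise_map {α : Type*} [MeasurableSpace α] [Finite α] [MeasurableSingletonClass α]
    (W : Measure α) [IsFiniteMeasure W] (x : α → ℂ) :
    (W.prod complexNoise).map (fun ω => (ω.1, x ω.1 + ω.2))
      = (W.prod volume).withDensity
        fun ω => ENNReal.ofReal (complexGaussianPDF (x ω.1) (1 / 2) ω.2) := by
  have hx : Measurable x := measurable_of_finite _
  have hT : Measurable fun ω : α × ℂ => (ω.1, x ω.1 + ω.2) := by fun_prop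
  have hd : Measurable fun ω : α × ℂ =>
      ENNReal.ofReal (complexGaussianPDF (x ω.1) (1 / 2) ω.2) :=
    (measurable_from_prod_countable_right
      fun a => measurable_complexGaussianPDF (x a) (1 / 2)).ennreal_ofReal
  ext s hs
  rw [Measure.map_apply hT hs, Measure.prod_apply (hT hs), withDensity_apply _ hs,
    ← lintegral_indicator hs, lintegral_prod _ (hd.indicator hs).aemeasurable]
  refine lintegral_congr fun a => ?_
  have h := congrArg (fun μ : Measure ℂ => μ (Prod.mk a ⁻¹' s)) (complexNoise_map_const_add (x a))
  rw [Measure.map_apply (by fun_prop) (measurable_prodMk_left hs),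
    withDensity_apply _ (measurable_prodMk_left hs),
    ← lintegral_indicator (measurable_prodMk_left hs)] at h
  exact h

lemma complexGaussianPDF_eq (m : ℂ) (v : ℝ≥0) (z : ℂ) :
    complexGaussianPDF m v z = (2 * Real.pi * v)⁻¹ *
      Real.exp (-((z.re - m.re) ^ 2 + (z.im - m.im) ^ 2) / (2 * v)) := by
  have h : (0 : ℝ) ≤ 2 * Real.pi * v := by positivity
  rw [complexGaussianPDF, gaussianPDFReal, gaussianPDFReal, mul_mul_mul_comm, ← Real.exp_add,
    ← mul_inv, Real.mul_self_sqrt h]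
  congr 2
  ring

lemma log_complexGaussianPDF_div (x z : ℂ) {s : ℝ} (hs : 0 < s) :
    Real.log (complexGaussianPDF x (1 / 2) (x + z) / complexGaussianPDF 0 (s / 2).toNNReal (x + z))
      = Real.log s + (1 / s - 1) * (z.re ^ 2 + z.im ^ 2)
        + 2 / s * (x.re * z.re + x.im * z.im) + ‖x‖ ^ 2 / s := by
  have hpi := Real.pi_pos
  rw [complexGaussianPDF_eq, complexGaussianPDF_eq, Real.coe_toNNReal _ (by positivity),
    mul_div_mul_comm, ← Real.exp_sub, Real.log_mul (by positivity) (Real.exp_pos _).ne',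
    Real.log_exp, Complex.sq_norm, Complex.normSq_apply]
  have h1 : (2 * Real.pi * ((1 / 2 : ℝ≥0) : ℝ))⁻¹ / (2 * Real.pi * (s / 2))⁻¹ = s := by
    push_cast
    field_simp
  rw [h1]
  push_cast
  simp only [Complex.add_re, Complex.add_im, Complex.zero_re, Complex.zero_im]
  field_simp
  ring

lemma integrable_re_pow_complexNoise (k : ℕ) : Integrable (fun z : ℂ => z.re ^ k) complexNoise := by
  have h := integrable_pow_gaussianReal 0 (1 / 2) k
  rw [← complexNoise_map_re] at h
  exact h.comp_measurable Complex.measurable_re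

lemma integrable_im_pow_complexNoise (k : ℕ) : Integrable (fun z : ℂ => z.im ^ k) complexNoise := by
  have h := integrable_pow_gaussianReal 0 (1 / 2) k
  rw [← complexNoise_map_im] at h
  exact h.comp_measurable Complex.measurable_im

lemma integral_comp_re_complexNoise {f : ℝ → ℝ} (hf : Measurable f) :
    ∫ z, f z.re ∂complexNoise = ∫ x, f x ∂gaussianReal 0 (1 / 2) := by
  rw [← complexNoise_map_re, integral_map Complex.measurable_re.aemeasurable
    hf.aestronglyMeasurable]

lemma integral_comp_im_complexNoise {f : ℝ → ℝ} (hf : Measurable f) :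
    ∫ z, f z.im ∂complexNoise = ∫ x, f x ∂gaussianReal 0 (1 / 2) := by
  rw [← complexNoise_map_im, integral_map Complex.measurable_im.aemeasurable
    hf.aestronglyMeasurable]

lemma integral_quadratic_complexNoise (A B C D : ℝ) :
    Integrable (fun z : ℂ => A + B * (z.re ^ 2 + z.im ^ 2) + (C * z.re + D * z.im)) complexNoise ∧
    ∫ z : ℂ, (A + B * (z.re ^ 2 + z.im ^ 2) + (C * z.re + D * z.im)) ∂complexNoise = A + B := by
  have r1 : Integrable (fun z : ℂ => z.re) complexNoise := by
    simpa using integrable_re_pow_complexNoise 1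
  have i1 : Integrable (fun z : ℂ => z.im) complexNoise := by
    simpa using integrable_im_pow_complexNoise 1
  have r2 := integrable_re_pow_complexNoise 2
  have i2 := integrable_im_pow_complexNoise 2
  have hq : Integrable (fun z : ℂ => B * (z.re ^ 2 + z.im ^ 2)) complexNoise :=
    (r2.add i2).const_mul B
  have hl : Integrable (fun z : ℂ => C * z.re + D * z.im) complexNoise :=
    (r1.const_mul C).add (i1.const_mul D)
  have hA : Integrable (fun _ : ℂ => A) complexNoise := integrable_const A
  have hAq : Integrable (fun z : ℂ => A + B * (z.re ^ 2 + z.im ^ 2)) complexNoise := hA.add hq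
  refine ⟨hAq.add hl, ?_⟩
  obtain ⟨m1, m2, -, -⟩ := integral_pow_gaussianReal_zero (1 / 2)
  rw [integral_add hAq hl, integral_add hA hq, integral_const_mul, integral_add r2 i2,
    integral_add (r1.const_mul C) (i1.const_mul D), integral_const_mul, integral_const_mul,
    integral_comp_re_complexNoise (f := fun x => x ^ 2) (by fun_prop),
    integral_comp_im_complexNoise (f := fun x => x ^ 2) (by fun_prop),
    integral_comp_re_complexNoise (f := fun x => x) (by fun_prop),
    integral_comp_im_complexNoise (f := fun x => x) (by fun_prop), m1, m2]
  simp
  norm_num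

-- Upper bound by the Gaussian capacity.

instance (n : ℕ) (p : Fin n ⊕ Fin n → PMF Bool) : IsProbabilityMeasure (labelLaw n p) := by
  unfold labelLaw
  infer_instance

/-- The rate of BICM is at most the capacity of the complex Gaussian channel. -/
theorem bicmRate_le_log (n : ℕ) (p : Fin n ⊕ Fin n → PMF Bool) {a : ℂ} {c snr : ℝ}
    (h : IsNormalized n p a c) (hsnr : 0 < snr) :
    bicmRate n p a c snr ≤ ENNReal.ofReal (Real.log (1 + snr)) := by
  set x : QAMLabel n → ℂ := fun b => (Real.sqrt snr : ℂ) * qamSymbol n a c b with hx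
  have hxm : Measurable x := measurable_of_finite _
  set T : QAMLabel n × ℂ → QAMLabel n × ℂ := fun ω => (ω.1, x ω.1 + ω.2) with hT
  have hTm : Measurable T := by fun_prop
  set M := ((labelLaw n p).prod complexNoise).map T with hM
  have hs : 0 < 1 + snr := by linarith
  have hv : ((1 + snr) / 2).toNNReal ≠ 0 := (Real.toNNReal_pos.2 (by positivity)).ne'
  have hv' : (1 / 2 : ℝ≥0) ≠ 0 := by norm_num
  set q : QAMLabel n → ℂ → ℝ := fun b => complexGaussianPDF (x b) (1 / 2) with hq
  -- Total variance `1 + snr` matches the energy of `Y`. The non-logarithmic terms of the expected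
  -- log ratio then cancel: `snr / (1 + snr) + 1 / (1 + snr) - 1 = 0`.
  set g : ℂ → ℝ := complexGaussianPDF 0 ((1 + snr) / 2).toNNReal with hg
  have hqm : Measurable fun ω : QAMLabel n × ℂ => q ω.1 ω.2 :=
    measurable_from_prod_countable_right fun b => measurable_complexGaussianPDF (x b) (1 / 2)
  have hgm : Measurable g := measurable_complexGaussianPDF _ _
  have hlm : Measurable fun ω : QAMLabel n × ℂ => Real.log (q ω.1 ω.2 / g ω.2) :=
    (hqm.div (hgm.comp measurable_snd)).log
  have hexp : ∀ b z, Real.log (q b (x b + z) / g (x b + z))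
      = (Real.log (1 + snr) + ‖x b‖ ^ 2 / (1 + snr)) + (1 / (1 + snr) - 1) * (z.re ^ 2 + z.im ^ 2)
        + (2 / (1 + snr) * (x b).re * z.re + 2 / (1 + snr) * (x b).im * z.im) := by
    intro b z
    rw [hq, hg]
    simp only
    rw [log_complexGaussianPDF_div _ _ hs]
    ring
  have hint0 : Integrable (fun ω : QAMLabel n × ℂ =>
      Real.log (q ω.1 (x ω.1 + ω.2) / g (x ω.1 + ω.2))) ((labelLaw n p).prod complexNoise) := by
    refine integrable_prod_of_finite (hlm.comp hTm).aestronglyMeasurable fun b => ?_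
    simp only [hexp]
    exact (integral_quadratic_complexNoise _ _ _ _).1
  have hint : Integrable (fun ω => Real.log (q ω.1 ω.2 / g ω.2)) M :=
    (integrable_map_measure hlm.aestronglyMeasurable hTm.aemeasurable).2 hint0
  have hmain := sum_mutualInfo_le p volume hqm (fun b y => complexGaussianPDF_pos _ hv' _)
    (fun b => lintegral_complexGaussianPDF _ hv') hgm (fun y => complexGaussianPDF_pos _ hv _)
    (lintegral_complexGaussianPDF _ hv) (prod_complexNoise_map (labelLaw n p) x) hint
  have hval : ∫ ω, Real.log (q ω.1 ω.2 / g ω.2) ∂M = Real.log (1 + snr) := by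
    rw [hM, integral_map hTm.aemeasurable hlm.aestronglyMeasurable]
    change ∫ ω : QAMLabel n × ℂ, Real.log (q ω.1 (x ω.1 + ω.2) / g (x ω.1 + ω.2))
      ∂((labelLaw n p).prod complexNoise) = _
    rw [integral_prod _ hint0]
    simp only [hexp, (integral_quadratic_complexNoise _ _ _ _).2]
    have hn : ∀ b, ‖x b‖ ^ 2 = snr * ‖qamSymbol n a c b‖ ^ 2 := by
      intro b
      rw [hx]
      simp only [norm_mul, Complex.norm_real, mul_pow, Real.norm_eq_abs, sq_abs]
      rw [Real.sq_sqrt hsnr.le]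
    have : ∀ b, Real.log (1 + snr) + ‖x b‖ ^ 2 / (1 + snr) + (1 / (1 + snr) - 1)
        = (Real.log (1 + snr) + (1 / (1 + snr) - 1))
          + snr / (1 + snr) * ‖qamSymbol n a c b‖ ^ 2 := by
      intro b
      rw [hn]
      ring
    simp only [this]
    rw [integral_add (integrable_const _) Integrable.of_finite, integral_const_mul, h.2.2]
    simp only [integral_const, probReal_univ, smul_eq_mul, one_mul]
    field_simp
    ring
  rw [hval] at hmain
  refine le_trans (le_of_eq ?_) hmain
  refine Finset.sum_congr rfl fun j _ => ?_
  rw [Measure.map_map (by fun_prop) hTm]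
  rfl

-- Antipodal signalling with a polynomial test function.

lemma nonneg_of_hasDerivAt_nonneg {f f' : ℝ → ℝ} (hf : ∀ x, HasDerivAt f (f' x) x) (h0 : f 0 = 0)
    (h : ∀ x, 0 ≤ x → 0 ≤ f' x) {x : ℝ} (hx : 0 ≤ x) : 0 ≤ f x := by
  rw [← h0]
  refine monotoneOn_of_deriv_nonneg (convex_Ici 0)
    (fun y _ => (hf y).continuousAt.continuousWithinAt)
    (fun y _ => (hf y).differentiableAt.differentiableWithinAt) (fun y hy => ?_)
    (Set.mem_Ici.2 le_rfl) hx hx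
  rw [interior_Ici] at hy
  rw [(hf y).deriv]
  exact h y (le_of_lt hy)

lemma hasDerivAt_tanh (x : ℝ) : HasDerivAt Real.tanh (1 - Real.tanh x ^ 2) x := by
  have h := (Real.hasDerivAt_sinh x).div (Real.hasDerivAt_cosh x) (Real.cosh_pos x).ne'
  have he : Real.tanh = Real.sinh / Real.cosh := funext fun y => Real.tanh_eq_sinh_div_cosh y
  rw [he]
  refine h.congr_deriv ?_
  have := (Real.cosh_pos x).ne'
  simp only [Pi.div_apply]
  field_simp

/-- The derivative of `log cosh` is `tanh`, and `tanh' = 1 - tanh²` turns a bound on `tanh` into the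
opposite, sharper one: `tanh y ≤ y`, then `tanh y ≥ y - y³/3`, then `tanh y ≤ y - y³/3 + 2y⁵/15`.
One more integration gives the exponent. -/
lemma cosh_le_exp_sextic (x : ℝ) :
    Real.cosh x ≤ Real.exp (x ^ 2 / 2 - x ^ 4 / 12 + x ^ 6 / 45) := by
  wlog hx : 0 ≤ x generalizing x
  · have h := this (-x) (by linarith)
    rw [Real.cosh_neg] at h
    refine h.trans_eq ?_
    congr 1
    ring
  have hp : ∀ (k : ℕ) (y : ℝ), HasDerivAt (fun y : ℝ => y ^ (k + 1)) ((k + 1) * y ^ k) y := by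
    intro k y
    simpa using hasDerivAt_pow (k + 1) y
  have t0 : ∀ y : ℝ, 0 ≤ y → 0 ≤ Real.tanh y := fun y hy => by
    rw [Real.tanh_eq_sinh_div_cosh]
    exact div_nonneg (Real.sinh_nonneg_iff.2 hy) (Real.cosh_pos y).le
  have t1 : ∀ y : ℝ, 0 ≤ y → 0 ≤ y - Real.tanh y := fun y hy =>
    nonneg_of_hasDerivAt_nonneg (f := fun y => y - Real.tanh y)
      (fun z => (hasDerivAt_id z).sub (hasDerivAt_tanh z)) (by simp)
      (fun z _ => by nlinarith [sq_nonneg (Real.tanh z)]) hy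
  have t2 : ∀ y : ℝ, 0 ≤ y → 0 ≤ Real.tanh y - (y - y ^ 3 / 3) := fun y hy =>
    nonneg_of_hasDerivAt_nonneg (f := fun y => Real.tanh y - (y - y ^ 3 / 3))
      (fun z => (hasDerivAt_tanh z).sub ((hasDerivAt_id z).sub ((hp 2 z).div_const 3))) (by simp)
      (fun z hz => by
        have h1 := t0 z hz
        have h2 := t1 z hz
        norm_num
        nlinarith) hy
  have t3 : ∀ y : ℝ, 0 ≤ y → 0 ≤ (y - y ^ 3 / 3 + 2 * y ^ 5 / 15) - Real.tanh y := fun y hy =>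
    nonneg_of_hasDerivAt_nonneg (f := fun y => (y - y ^ 3 / 3 + 2 * y ^ 5 / 15) - Real.tanh y)
      (fun z => (((hasDerivAt_id z).sub ((hp 2 z).div_const 3)).add
        (((hp 4 z).const_mul 2).div_const 15)).sub (hasDerivAt_tanh z)) (by simp)
      (fun z hz => by
        have h1 := t0 z hz
        have h2 := t2 z hz
        norm_num
        -- The claim is `tanh² z ≥ z² - 2z⁴/3`. For small `z` the previous lower bound is
        -- nonnegative and may be squared; for `z² ≥ 3/2` the right side is nonpositive.
        rcases le_total (z ^ 2) (3 / 2) with h3 | h3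
        · have h4 : 0 ≤ z - z ^ 3 / 3 := by
            have : z - z ^ 3 / 3 = z * (1 - z ^ 2 / 3) := by ring
            rw [this]
            exact mul_nonneg hz (by linarith)
          have h5 : (z - z ^ 3 / 3) ^ 2 ≤ Real.tanh z ^ 2 := pow_le_pow_left₀ h4 (by linarith) 2
          nlinarith [sq_nonneg (z ^ 3)]
        · nlinarith [sq_nonneg (Real.tanh z), mul_nonneg (sq_nonneg z) (sub_nonneg.2 h3)]) hy
  have t4 : 0 ≤ (x ^ 2 / 2 - x ^ 4 / 12 + x ^ 6 / 45) - Real.log (Real.cosh x) :=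
    nonneg_of_hasDerivAt_nonneg
      (f := fun y => (y ^ 2 / 2 - y ^ 4 / 12 + y ^ 6 / 45) - Real.log (Real.cosh y))
      (fun z => ((((hp 1 z).div_const 2).sub ((hp 3 z).div_const 12)).add
        ((hp 5 z).div_const 45)).sub ((Real.hasDerivAt_cosh z).log (Real.cosh_pos z).ne')) (by simp)
      (fun z hz => by
        have h := t3 z hz
        rw [Real.tanh_eq_sinh_div_cosh] at h
        norm_num
        linarith) hx
  rw [← Real.log_le_iff_le_exp (Real.cosh_pos x)]
  linarith

/-- Log-likelihood test function for binary antipodal signalling with amplitude `s`, with the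
logarithm of `cosh` replaced by a polynomial upper bound. -/
noncomputable def antipodalTest (s : ℝ) (x : Bool) (y : ℝ) : ℝ :=
  2 * (if x then s else -s) * y - ((2 * s * y) ^ 2 / 2 - (2 * s * y) ^ 4 / 12 + (2 * s * y) ^ 6 / 45)

/-- The sum is `2 cosh (2sy) exp (-P)` with `P` the majorant of `log cosh`. This pointwise bound in
`y` gives the Donsker-Varadhan constraint for a uniform bit. -/
lemma exp_antipodalTest_add_le (s y : ℝ) :
    Real.exp (antipodalTest s true y) + Real.exp (antipodalTest s false y) ≤ 2 := by
  have h := cosh_le_exp_sextic (2 * s * y)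
  rw [Real.cosh_eq] at h
  set P := (2 * s * y) ^ 2 / 2 - (2 * s * y) ^ 4 / 12 + (2 * s * y) ^ 6 / 45 with hP
  have h1 : antipodalTest s true y = 2 * s * y + -P := by simp [antipodalTest, hP, sub_eq_add_neg]
  have h2 : antipodalTest s false y = -(2 * s * y) + -P := by
    simp only [antipodalTest, hP]
    norm_num
    ring
  rw [h1, h2, Real.exp_add, Real.exp_add, ← add_mul, Real.exp_neg P,
    ← div_eq_mul_inv, div_le_iff₀ (Real.exp_pos _)]
  linarith

lemma integrable_polynomial_gaussianReal (m : ℝ) (v : ℝ≥0) (P : Polynomial ℝ) :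
    Integrable (fun x => P.eval x) (gaussianReal m v) := by
  simp only [Polynomial.eval_eq_sum_range]
  exact integrable_finsetSum _ fun i _ => (integrable_pow_gaussianReal m v i).const_mul _

lemma integrable_antipodalTest (s m : ℝ) (x : Bool) :
    Integrable (fun z => antipodalTest s x (m + z)) (gaussianReal 0 (1 / 2)) := by
  have h := integrable_polynomial_gaussianReal 0 (1 / 2)
    (.C (2 * (if x then s else -s)) * (.C m + .X) - (.C (1 / 2) * (.C (2 * s) * (.C m + .X)) ^ 2
      - .C (1 / 12) * (.C (2 * s) * (.C m + .X)) ^ 4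
      + .C (1 / 45) * (.C (2 * s) * (.C m + .X)) ^ 6))
  refine h.congr (ae_of_all _ fun z => ?_)
  simp only [Polynomial.eval_sub, Polynomial.eval_add, Polynomial.eval_mul, Polynomial.eval_pow,
    Polynomial.eval_C, Polynomial.eval_X, antipodalTest]
  ring

/-- Expand in the noise and insert its moments with variance `1/2`. Through order `s⁴` the linear
term contributes `2s²`, the quadratic one `-s² - 2s⁴` and the quartic one `s⁴`; the sextic term is
absorbed in `C`. -/
lemma exists_le_integral_antipodalTest : ∃ C : ℝ, ∀ (s : ℝ) (x : Bool), 0 ≤ s → s ≤ 1 →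
    s ^ 2 - s ^ 4 - C * s ^ 6
      ≤ ∫ z, antipodalTest s x ((if x then s else -s) + z) ∂gaussianReal 0 (1 / 2) := by
  set K := ∫ z, z ^ 6 ∂gaussianReal 0 (1 / 2) with hK
  refine ⟨64 / 45 * (32 * (1 + K)), fun s x hs0 hs1 => ?_⟩
  set m : ℝ := if x then s else -s with hm
  have hm2 : m ^ 2 = s ^ 2 := by cases x <;> simp [hm]
  have hm4 : m ^ 4 = s ^ 4 := by rw [show m ^ 4 = (m ^ 2) ^ 2 by ring, hm2]; ring
  have hm6 : m ^ 6 ≤ 1 := by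
    rw [show m ^ 6 = (m ^ 2) ^ 3 by ring, hm2, ← pow_mul]
    exact pow_le_one₀ hs0 hs1
  -- By convexity `(m + z)⁶ ≤ 2⁵ (m⁶ + z⁶)`, so the sixth moment `K` enters only through `C` and
  -- need not be computed.
  have hsix : ∀ z : ℝ, (m + z) ^ 6 ≤ 32 * (1 + z ^ 6) := by
    intro z
    have h1 : (m + z) ^ 6 ≤ 32 * (m ^ 6 + z ^ 6) := by
      have h2 : (m + z) ^ 2 ≤ 2 * (m ^ 2 + z ^ 2) := by nlinarith [sq_nonneg (m - z)]
      have h3 : ((m + z) ^ 2) ^ 3 ≤ (2 * (m ^ 2 + z ^ 2)) ^ 3 :=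
        pow_le_pow_left₀ (sq_nonneg _) h2 3
      nlinarith [mul_nonneg (add_nonneg (sq_nonneg m) (sq_nonneg z)) (sq_nonneg (m ^ 2 - z ^ 2))]
    linarith
  obtain ⟨m1, m2, m3, m4⟩ := integral_pow_gaussianReal_zero (1 / 2)
  have i := integrable_pow_gaussianReal 0 (1 / 2)
  have i1 : Integrable (fun z : ℝ => z) (gaussianReal 0 (1 / 2)) := by simpa using i 1
  have hlow : ∀ z, 2 * m * m - 2 * s ^ 2 * m ^ 2 + 4 / 3 * s ^ 4 * m ^ 4
        - 64 / 45 * s ^ 6 * 32 + (2 * m - 4 * s ^ 2 * m + 16 / 3 * s ^ 4 * m ^ 3) * z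
        + (8 * s ^ 4 * m ^ 2 - 2 * s ^ 2) * z ^ 2 + 16 / 3 * s ^ 4 * m * z ^ 3
        + 4 / 3 * s ^ 4 * z ^ 4 + (-(64 / 45 * s ^ 6 * 32)) * z ^ 6
      ≤ antipodalTest s x (m + z) := by
    intro z
    have h := mul_le_mul_of_nonneg_left (hsix z) (by positivity : 0 ≤ 64 / 45 * s ^ 6)
    rw [antipodalTest, ← hm]
    nlinarith
  have c0 : Integrable (fun _ : ℝ => 2 * m * m - 2 * s ^ 2 * m ^ 2 + 4 / 3 * s ^ 4 * m ^ 4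
      - 64 / 45 * s ^ 6 * 32) (gaussianReal 0 (1 / 2)) := integrable_const _
  have c1 := c0.add (i1.const_mul (2 * m - 4 * s ^ 2 * m + 16 / 3 * s ^ 4 * m ^ 3))
  have c2 := c1.add ((i 2).const_mul (8 * s ^ 4 * m ^ 2 - 2 * s ^ 2))
  have c3 := c2.add ((i 3).const_mul (16 / 3 * s ^ 4 * m))
  have c4 := c3.add ((i 4).const_mul (4 / 3 * s ^ 4))
  have c6 := c4.add ((i 6).const_mul (-(64 / 45 * s ^ 6 * 32)))
  have h := integral_mono c6 (integrable_antipodalTest s m x) hlow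
  rw [integral_add' c4 ((i 6).const_mul _), integral_add' c3 ((i 4).const_mul _),
    integral_add' c2 ((i 3).const_mul _), integral_add' c1 ((i 2).const_mul _),
    integral_add' c0 (i1.const_mul _), integral_const_mul _ fun z : ℝ => z] at h
  simp only [integral_const_mul, m1, m2, m3, m4, ← hK, integral_const, probReal_univ,
    smul_eq_mul] at h
  refine le_trans ?_ h
  have e1 : 2 * m * m = 2 * s ^ 2 := by rw [← hm2]; ring
  rw [e1, hm4, hm2]
  push_cast
  have hs8 : 0 ≤ s ^ 8 := by positivity
  have hs6 : 0 ≤ s ^ 6 := by positivity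
  ring_nf
  nlinarith

lemma lintegral_uniform_bool (q : PMF Bool) (hq : ∀ x, q x = 1 / 2) (f : Bool → ℝ≥0∞) :
    ∫⁻ x, f x ∂q.toMeasure = (f true + f false) / 2 := by
  rw [lintegral_fintype]
  simp only [PMF.toMeasure_apply_singleton _ _ (measurableSet_singleton _), hq, Fintype.sum_bool]
  rw [← add_mul, mul_one_div]

/-- A uniform bit that determines one real component `φ` of the channel input with amplitude
`1 / √2` conveys as much information as binary antipodal signalling does. -/
lemma ofReal_le_mutualInfo_bitOutputLaw {n : ℕ} {p : Fin n ⊕ Fin n → PMF Bool} {a : ℂ} {c : ℝ}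
    (j : Fin n ⊕ Fin n) (hp : ∀ x, p j x = 1 / 2) {φ : ℂ → ℝ} (hφ : Measurable φ)
    (hadd : ∀ (t : ℝ) (x z : ℂ), φ (t * x + z) = t * φ x + φ z)
    (hnoise : complexNoise.map φ = gaussianReal 0 (1 / 2))
    (hsym : ∀ᵐ b ∂labelLaw n p, φ (qamSymbol n a c b) =
      if b j then 1 / Real.sqrt 2 else -(1 / Real.sqrt 2))
    {snr L : ℝ}
    (hL : ∀ x, L ≤ ∫ z, antipodalTest (Real.sqrt snr / Real.sqrt 2) x
      ((if x then Real.sqrt snr / Real.sqrt 2 else -(Real.sqrt snr / Real.sqrt 2)) + z)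
        ∂gaussianReal 0 (1 / 2)) :
    ENNReal.ofReal L ≤ mutualInfo (bitOutputLaw n p a c snr j) := by
  set s := Real.sqrt snr / Real.sqrt 2 with hs
  have hXm : Measurable (qamSymbol n a c) := measurable_of_finite _
  set T : QAMLabel n × ℂ → Bool × ℂ :=
    fun ω => (ω.1 j, (Real.sqrt snr : ℂ) * qamSymbol n a c ω.1 + ω.2) with hT
  have hTm : Measurable T := by fun_prop
  have hρ : bitOutputLaw n p a c snr j = ((labelLaw n p).prod complexNoise).map T := rfl
  have hprob : IsProbabilityMeasure (bitOutputLaw n p a c snr j) := by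
    rw [hρ]
    exact Measure.isProbabilityMeasure_map hTm.aemeasurable
  have hatm : ∀ x, Measurable (antipodalTest s x) := fun x => by
    unfold antipodalTest
    fun_prop
  set f : Bool × ℂ → ℝ := fun ω => antipodalTest s ω.1 (φ ω.2) with hf
  have hfm : Measurable f := measurable_from_prod_countable_right fun x => (hatm x).comp hφ
  have hcomp : ∀ b z, φ (qamSymbol n a c b) =
      (if b j then 1 / Real.sqrt 2 else -(1 / Real.sqrt 2)) →
      f (T (b, z)) = antipodalTest s (b j) ((if b j then s else -s) + φ z) := by
    intro b z hb
    simp only [hf, hT, hadd, hb]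
    congr 2
    split_ifs <;> rw [hs] <;> ring
  have hinner : ∀ x : Bool, Integrable
      (fun z => antipodalTest s x ((if x then s else -s) + φ z)) complexNoise := by
    intro x
    have h := integrable_antipodalTest s (if x then s else -s) x
    rw [← hnoise] at h
    exact h.comp_measurable hφ
  have hint0 : Integrable (fun ω => f (T ω)) ((labelLaw n p).prod complexNoise) := by
    have hg : Integrable (fun ω : QAMLabel n × ℂ =>
        antipodalTest s (ω.1 j) ((if ω.1 j then s else -s) + φ ω.2))
        ((labelLaw n p).prod complexNoise) := by
      refine integrable_prod_of_finite ?_ fun b => hinner (b j)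
      refine Measurable.aestronglyMeasurable (measurable_from_prod_countable_right fun b => ?_)
      exact (hatm (b j)).comp (hφ.const_add (if b j then s else -s))
    refine hg.congr ?_
    have := Measure.quasiMeasurePreserving_fst (μ := labelLaw n p) (ν := complexNoise) |>.ae hsym
    filter_upwards [this] with ω hω
    exact (hcomp ω.1 ω.2 hω).symm
  have hint : Integrable f (bitOutputLaw n p a c snr j) :=
    (integrable_map_measure hfm.aestronglyMeasurable hTm.aemeasurable).2 hint0
  have hfst : (bitOutputLaw n p a c snr j).fst = (p j).toMeasure := by
    have h1 : (bitOutputLaw n p a c snr j).fst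
        = (((labelLaw n p).prod complexNoise).map Prod.fst).map (Function.eval j) := by
      rw [Measure.fst, hρ, Measure.map_map measurable_fst hTm,
        Measure.map_map (measurable_pi_apply j) measurable_fst]
      rfl
    rw [h1, Measure.map_fst_prod, measure_univ, one_smul, labelLaw, Measure.pi_map_eval,
      Finset.prod_eq_one fun i _ => measure_univ, one_smul]
  refine le_trans (ENNReal.ofReal_le_ofReal ?_) (ofReal_integral_le_klDiv hint hfm ?_)
  · rw [hρ, integral_map hTm.aemeasurable hfm.aestronglyMeasurable, integral_prod _ hint0]
    have hc : ∫ _, L ∂labelLaw n p = L := by simp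
    rw [← hc]
    refine integral_mono_ae Integrable.of_finite Integrable.of_finite ?_
    filter_upwards [hsym] with b hb
    refine (hL (b j)).trans_eq ?_
    simp only [fun z => hcomp b z hb]
    have hm : Measurable fun z => antipodalTest s (b j) ((if b j then s else -s) + z) :=
      (hatm (b j)).comp (measurable_id.const_add (if b j then s else -s))
    rw [← hnoise, integral_map hφ.aemeasurable hm.aestronglyMeasurable]
  · have hem : Measurable fun ω => ENNReal.ofReal (Real.exp (f ω)) := hfm.exp.ennreal_ofReal
    rw [lintegral_prod_symm _ hem.aemeasurable, hfst]
    have hle : ∀ y : ℂ, ∫⁻ x, ENNReal.ofReal (Real.exp (f (x, y))) ∂(p j).toMeasure ≤ 1 := by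
      intro y
      rw [lintegral_uniform_bool _ hp, ← ENNReal.ofReal_add (Real.exp_pos _).le (Real.exp_pos _).le]
      refine ENNReal.div_le_of_le_mul ?_
      rw [one_mul]
      exact (ENNReal.ofReal_le_ofReal (exp_antipodalTest_add_le s (φ y))).trans_eq (by simp)
    exact (lintegral_mono hle).trans (by simp)

-- From two-sided bounds to the expansion.

lemma hasLowSNRExpansion_of_bounds {R : ℝ → ℝ≥0∞} {C : ℝ}
    (hle : ∀ s : ℝ, 0 < s → R s ≤ ENNReal.ofReal (Real.log (1 + s)))
    (hge : ∀ s : ℝ, 0 < s → s ≤ 1 → ENNReal.ofReal (s - s ^ 2 / 2 - C * s ^ 3) ≤ R s) :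
    HasLowSNRExpansion R 1 (-(1 / 2)) := by
  have hfin : ∀ s : ℝ, 0 < s → R s ≠ ∞ := fun s hs => ne_top_of_le_ne_top ENNReal.ofReal_ne_top
    (hle s hs)
  refine ⟨hfin, ?_⟩
  have hO : (fun s : ℝ => (R s).toReal - (1 * s + -(1 / 2) * s ^ 2)) =O[𝓝[>] 0]
      fun s => s ^ 3 := by
    refine IsBigO.of_bound (|C| + 2) ?_
    have hmem : Set.Ioc (0 : ℝ) (1 / 2) ∈ 𝓝[>] (0 : ℝ) := Ioc_mem_nhdsGT (by norm_num)
    filter_upwards [hmem] with s hs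
    obtain ⟨h0, h1⟩ := hs
    have h3 : 0 < s ^ 3 := by positivity
    have hlog0 : 0 ≤ Real.log (1 + s) := Real.log_nonneg (by linarith)
    have hup : (R s).toReal ≤ Real.log (1 + s) := ENNReal.toReal_le_of_le_ofReal hlog0 (hle s h0)
    have hlow : s - s ^ 2 / 2 - C * s ^ 3 ≤ (R s).toReal :=
      (ENNReal.ofReal_le_iff_le_toReal (hfin s h0)).1 (hge s h0 (by linarith))
    -- Taylor bound for `log (1 - x)` at `x = -s` with two terms; the remainder `s³ / (1 - s)` is at
    -- most `2s³` because `s ≤ 1/2`.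
    have hlog := Real.abs_log_sub_add_sum_range_le (x := -s) (by rw [abs_neg, abs_of_pos h0]; linarith) 2
    rw [abs_neg, abs_of_pos h0] at hlog
    have hlog' := (abs_le.1 hlog).2
    simp only [Finset.sum_range_succ, Finset.sum_range_zero] at hlog'
    norm_num at hlog'
    have hq : s ^ 3 / (1 - s) ≤ 2 * s ^ 3 := by
      rw [div_le_iff₀ (by linarith)]
      nlinarith
    have hC := mul_le_mul_of_nonneg_right (le_abs_self C) h3.le
    have hC' := mul_nonneg (abs_nonneg C) h3.le
    rw [Real.norm_eq_abs, Real.norm_eq_abs, abs_of_pos h3, abs_le]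
    constructor <;> nlinarith
  refine hO.trans_isLittleO (IsLittleO.mono ?_ nhdsWithin_le_nhds)
  exact isLittleO_pow_pow (by norm_num)

-- Corner points: QPSK inside square QAM.

/-- Bit distributions that select the four corner points: the leading bit of each component is
uniform, all the other bits are `0`. -/
noncomputable def cornerBits (k : ℕ) : Fin (k + 1) ⊕ Fin (k + 1) → PMF Bool :=
  Sum.elim (Fin.cons (PMF.uniformOfFintype Bool) fun _ => PMF.pure false)
    (Fin.cons (PMF.uniformOfFintype Bool) fun _ => PMF.pure false)

/-- Labels of the four corner points. -/
def cornerLabel (k : ℕ) (x : Bool × Bool) : QAMLabel (k + 1) :=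
  Sum.elim (Fin.cons x.1 fun _ => false) (Fin.cons x.2 fun _ => false)

/-- Checked on boxes: if every frozen coordinate admits `false`, only the two leading factors
remain; otherwise both sides vanish. -/
lemma labelLaw_cornerBits (k : ℕ) : labelLaw (k + 1) (cornerBits k) =
    ((4 : ℝ≥0∞)⁻¹ • Measure.count : Measure (Bool × Bool)).map (cornerLabel k) := by
  have hU : (4 : ℝ≥0∞)⁻¹ • (Measure.count : Measure (Bool × Bool)) =
      (PMF.uniformOfFintype Bool).toMeasure.prod (PMF.uniformOfFintype Bool).toMeasure := by
    refine Measure.ext_of_singleton fun x => ?_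
    rw [← Set.singleton_prod_singleton (a := x.1) (b := x.2), Measure.prod_prod,
      PMF.toMeasure_apply_singleton _ _ (measurableSet_singleton _),
      PMF.toMeasure_apply_singleton _ _ (measurableSet_singleton _)]
    simp only [Set.singleton_prod_singleton, Measure.smul_apply, Measure.count_singleton,
      PMF.uniformOfFintype_apply, Fintype.card_bool, smul_eq_mul, mul_one]
    rw [← ENNReal.mul_inv (by simp) (by simp)]
    norm_num
  have hE : Measurable (cornerLabel k) := measurable_of_finite _
  rw [hU, labelLaw]
  refine Measure.pi_eq fun s hs => ?_
  rw [Measure.map_apply hE (MeasurableSet.univ_pi hs), Fintype.prod_sum_type, Fin.prod_univ_succ,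
    Fin.prod_univ_succ]
  simp only [cornerBits, Sum.elim_inl, Sum.elim_inr, Fin.cons_zero, Fin.cons_succ,
    PMF.toMeasure_pure, Measure.dirac_apply]
  by_cases h : (∀ i : Fin k, false ∈ s (Sum.inl i.succ)) ∧ ∀ i : Fin k, false ∈ s (Sum.inr i.succ)
  · have hpre : cornerLabel k ⁻¹' Set.univ.pi s = s (Sum.inl 0) ×ˢ s (Sum.inr 0) := by
      ext x
      simp only [Set.mem_preimage, Set.mem_univ_pi, Sum.forall, Fin.forall_fin_succ, cornerLabel,
        Sum.elim_inl, Sum.elim_inr, Fin.cons_zero, Fin.cons_succ, Set.mem_prod]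
      tauto
    rw [hpre, Measure.prod_prod, Finset.prod_eq_one fun i _ => by simp [h.1 i],
      Finset.prod_eq_one fun i _ => by simp [h.2 i], mul_one, mul_one]
  · have hpre : cornerLabel k ⁻¹' Set.univ.pi s = ∅ := by
      ext x
      simp only [Set.mem_preimage, Set.mem_univ_pi, Sum.forall, Fin.forall_fin_succ, cornerLabel,
        Sum.elim_inl, Sum.elim_inr, Fin.cons_zero, Fin.cons_succ, Set.mem_empty_iff_false]
      tauto
    rw [hpre, measure_empty]
    rw [not_and_or, not_forall, not_forall] at h
    rcases h with ⟨i, hi⟩ | ⟨i, hi⟩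
    · rw [Finset.prod_eq_zero (Finset.mem_univ i) (by simp [hi])]
      simp
    · rw [Finset.prod_eq_zero (i := i) (s := Finset.univ)
        (f := fun i : Fin k => (s (Sum.inr i.succ)).indicator (1 : Bool → ℝ≥0∞) false)
        (Finset.mem_univ i) (by simp [hi])]
      simp

lemma grayIndex_false (k : ℕ) : grayIndex k (fun _ => false) = 0 := by
  induction k with
  | zero => rfl
  | succ k ih =>
    rw [grayIndex, if_neg (by simp)]
    exact ih

/-- The all-zero tail stands first in its list, so reflection sends it to the very last position
when the leading bit is 1. -/
lemma pamPoint_cons_false (k : ℕ) (x : Bool) :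
    pamPoint (k + 1) (Fin.cons x fun _ => false)
      = if x then (2 : ℝ) ^ (k + 1) - 1 else -((2 : ℝ) ^ (k + 1) - 1) := by
  have h1 : 1 ≤ 2 ^ (k + 1) := Nat.one_le_two_pow
  cases x <;> simp [pamPoint, grayIndex, Fin.tail_cons, grayIndex_false, Nat.cast_sub h1]
  ring

/-- Scaling that puts the corner points on the unit circle. -/
noncomputable def cornerScale (k : ℕ) : ℝ := 1 / (Real.sqrt 2 * ((2 : ℝ) ^ (k + 1) - 1))

/-- Labelling of the QPSK constellation by two bits. -/
noncomputable def qpskPoint (x : Bool × Bool) : ℂ :=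
  ⟨if x.1 then 1 / Real.sqrt 2 else -(1 / Real.sqrt 2),
    if x.2 then 1 / Real.sqrt 2 else -(1 / Real.sqrt 2)⟩

lemma two_pow_succ_sub_one_pos (k : ℕ) : 0 < (2 : ℝ) ^ (k + 1) - 1 := by
  have : (1 : ℝ) < 2 ^ (k + 1) := one_lt_pow₀ (by norm_num) (by simp)
  linarith

lemma cornerScale_pos (k : ℕ) : 0 < cornerScale k := by
  have := two_pow_succ_sub_one_pos k
  unfold cornerScale
  positivity

lemma qamSymbol_cornerLabel (k : ℕ) (x : Bool × Bool) :
    qamSymbol (k + 1) 0 (cornerScale k) (cornerLabel k x) = qpskPoint x := by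
  have h := (two_pow_succ_sub_one_pos k).ne'
  have h2 : Real.sqrt 2 ≠ 0 := by positivity
  have key : ∀ y : Bool, cornerScale k * pamPoint (k + 1) (Fin.cons y fun _ => false)
      = if y then 1 / Real.sqrt 2 else -(1 / Real.sqrt 2) := by
    intro y
    rw [pamPoint_cons_false, cornerScale]
    cases y
    · simp only [Bool.false_eq_true, if_false]
      field_simp
    · simp only [if_true]
      field_simp
  rw [qamSymbol, sub_zero]
  apply Complex.ext
  · rw [Complex.re_ofReal_mul]
    exact key x.1
  · rw [Complex.im_ofReal_mul]
    exact key x.2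

lemma qpskPoint_injective : Function.Injective qpskPoint := by
  have h : (0 : ℝ) < 1 / Real.sqrt 2 := by positivity
  have key : ∀ x y : Bool, (if x then 1 / Real.sqrt 2 else -(1 / Real.sqrt 2))
      = (if y then 1 / Real.sqrt 2 else -(1 / Real.sqrt 2)) → x = y := by
    intro x y hxy
    cases x <;> cases y <;> simp only [Bool.false_eq_true, if_true, if_false] at hxy ⊢ <;> linarith
  intro x y hxy
  exact Prod.ext (key _ _ (congrArg Complex.re hxy)) (key _ _ (congrArg Complex.im hxy))

lemma range_qpskPoint : Set.range qpskPoint = qpsk := by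
  have h : (0 : ℝ) ≤ 1 / Real.sqrt 2 := by positivity
  ext z
  constructor
  · rintro ⟨⟨x, y⟩, rfl⟩
    constructor
    · cases x <;> simp [qpskPoint]
    · cases y <;> simp [qpskPoint]
  · rintro ⟨h1, h2⟩
    have key : ∀ t : ℝ, |t| = 1 / Real.sqrt 2 →
        ∃ x : Bool, (if x then 1 / Real.sqrt 2 else -(1 / Real.sqrt 2)) = t := by
      intro t ht
      rcases (abs_eq h).1 ht with ht | ht
      · exact ⟨true, by simp [ht]⟩
      · exact ⟨false, by simp [ht]⟩
    obtain ⟨x, hx⟩ := key _ h1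
    obtain ⟨y, hy⟩ := key _ h2
    exact ⟨(x, y), Complex.ext hx hy⟩

lemma map_qpskPoint_eq_uniformOn :
    ((4 : ℝ≥0∞)⁻¹ • Measure.count : Measure (Bool × Bool)).map qpskPoint = uniformOn qpsk := by
  have hm : Measurable qpskPoint := measurable_of_finite _
  have hq : MeasurableSet qpsk := by
    rw [← range_qpskPoint]
    exact (Set.finite_range _).measurableSet
  have hcount : Measure.count qpsk = 4 := by
    rw [← range_qpskPoint, ← Set.image_univ, Measure.count_injective_image qpskPoint_injective,
      Measure.count_univ]
    simp
  ext s hs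
  rw [Measure.map_apply hm hs, uniformOn, cond_apply hq, hcount, Measure.smul_apply, smul_eq_mul,
    ← range_qpskPoint, Set.inter_comm, ← Set.image_preimage_eq_inter_range,
    Measure.count_injective_image qpskPoint_injective]

lemma labelLaw_cornerBits_map (k : ℕ) :
    (labelLaw (k + 1) (cornerBits k)).map (qamSymbol (k + 1) 0 (cornerScale k))
      = uniformOn qpsk := by
  rw [labelLaw_cornerBits, Measure.map_map (measurable_of_finite _) (measurable_of_finite _),
    ← map_qpskPoint_eq_uniformOn]
  congr 1
  funext x
  exact qamSymbol_cornerLabel k x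

lemma integral_labelLaw_cornerBits {E : Type*} [NormedAddCommGroup E] [NormedSpace ℝ E]
    [CompleteSpace E] (k : ℕ) (f : ℂ → E) :
    ∫ b, f (qamSymbol (k + 1) 0 (cornerScale k) b) ∂labelLaw (k + 1) (cornerBits k)
      = (4 : ℝ)⁻¹ • ∑ x, f (qpskPoint x) := by
  rw [labelLaw_cornerBits, integral_map (measurable_of_finite _).aemeasurable
    (StronglyMeasurable.of_discrete).aestronglyMeasurable, integral_smul_measure]
  simp only [qamSymbol_cornerLabel]
  rw [integral_count]
  simp

lemma isNormalized_cornerBits (k : ℕ) :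
    IsNormalized (k + 1) (cornerBits k) 0 (cornerScale k) := by
  refine ⟨cornerScale_pos k, ?_, ?_⟩
  · rw [integral_labelLaw_cornerBits k fun z => z]
    rw [Fintype.sum_prod_type, Fintype.sum_bool, Fintype.sum_bool, Fintype.sum_bool]
    apply Complex.ext <;> simp [qpskPoint]
  · rw [integral_labelLaw_cornerBits k fun z => ‖z‖ ^ 2]
    have h : ∀ x, ‖qpskPoint x‖ ^ 2 = 1 := by
      intro x
      rw [Complex.sq_norm, Complex.normSq_apply]
      have h2 : 1 / Real.sqrt 2 * (1 / Real.sqrt 2) = 1 / 2 := by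
        rw [div_mul_div_comm, one_mul, Real.mul_self_sqrt (by norm_num)]
      obtain ⟨x, y⟩ := x
      cases x <;> cases y <;>
        simp only [qpskPoint, Bool.false_eq_true, if_true, if_false, neg_mul_neg, h2] <;> norm_num
    simp only [h]
    simp

lemma exists_le_bicmRate_cornerBits (k : ℕ) : ∃ C : ℝ, ∀ s : ℝ, 0 < s → s ≤ 1 →
    ENNReal.ofReal (s - s ^ 2 / 2 - C * s ^ 3)
      ≤ bicmRate (k + 1) (cornerBits k) 0 (cornerScale k) s := by
  obtain ⟨C, hC⟩ := exists_le_integral_antipodalTest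
  -- Two components of squared amplitude `s / 2` have total error `2 C (s/2)³ = C s³ / 4`.
  refine ⟨C / 4, fun s hs hs1 => ?_⟩
  have h0 : 0 ≤ Real.sqrt s / Real.sqrt 2 := by positivity
  have hsq : (Real.sqrt s / Real.sqrt 2) ^ 2 = s / 2 := by
    rw [div_pow, Real.sq_sqrt hs.le, Real.sq_sqrt (by norm_num)]
  have h1 : Real.sqrt s / Real.sqrt 2 ≤ 1 := by
    rw [← abs_of_nonneg h0, ← sq_le_one_iff_abs_le_one, hsq]
    linarith
  set L := s / 2 - (s / 2) ^ 2 - C * (s / 2) ^ 3 with hLdef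
  have hL : ∀ x, L ≤ ∫ z, antipodalTest (Real.sqrt s / Real.sqrt 2) x
      ((if x then Real.sqrt s / Real.sqrt 2 else -(Real.sqrt s / Real.sqrt 2)) + z)
        ∂gaussianReal 0 (1 / 2) := by
    intro x
    refine le_of_eq_of_le ?_ (hC _ x h0 h1)
    rw [hLdef, ← hsq]
    ring
  have hae : ∀ {P : QAMLabel (k + 1) → Prop}, (∀ x, P (cornerLabel k x)) →
      ∀ᵐ b ∂labelLaw (k + 1) (cornerBits k), P b := by
    intro P hP
    rw [labelLaw_cornerBits, ae_map_iff (measurable_of_finite _).aemeasurable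
      (Set.toFinite _).measurableSet]
    exact ae_of_all _ hP
  have hre : ENNReal.ofReal L
      ≤ mutualInfo (bitOutputLaw (k + 1) (cornerBits k) 0 (cornerScale k) s (Sum.inl 0)) := by
    refine ofReal_le_mutualInfo_bitOutputLaw (Sum.inl 0) (fun x => ?_) Complex.measurable_re
      (fun t x z => by rw [Complex.add_re, Complex.re_ofReal_mul]) complexNoise_map_re
      (hae fun x => ?_) hL
    · simp [cornerBits]
    · rw [qamSymbol_cornerLabel]
      rfl
  have him : ENNReal.ofReal L
      ≤ mutualInfo (bitOutputLaw (k + 1) (cornerBits k) 0 (cornerScale k) s (Sum.inr 0)) := by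
    refine ofReal_le_mutualInfo_bitOutputLaw (Sum.inr 0) (fun x => ?_) Complex.measurable_im
      (fun t x z => by rw [Complex.add_im, Complex.im_ofReal_mul]) complexNoise_map_im
      (hae fun x => ?_) hL
    · simp [cornerBits]
    · rw [qamSymbol_cornerLabel]
      rfl
  calc ENNReal.ofReal (s - s ^ 2 / 2 - C / 4 * s ^ 3) = ENNReal.ofReal (L + L) := by
        congr 1
        rw [hLdef]
        ring
    -- `L` may be negative, where `ENNReal.ofReal` truncates; subadditivity suffices. The frozen
    -- bits are then dropped from the rate, their terms being nonnegative.
    _ ≤ ENNReal.ofReal L + ENNReal.ofReal L := ENNReal.ofReal_add_le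
    _ ≤ _ := add_le_add hre him
    _ ≤ _ := by
        rw [bicmRate, Fintype.sum_sum_type]
        exact add_le_add
          (Finset.single_le_sum (f := fun i => mutualInfo (bitOutputLaw (k + 1) (cornerBits k) 0
            (cornerScale k) s (Sum.inl i))) (fun _ _ => zero_le) (Finset.mem_univ 0))
          (Finset.single_le_sum (f := fun i => mutualInfo (bitOutputLaw (k + 1) (cornerBits k) 0
            (cornerScale k) s (Sum.inr i))) (fun _ _ => zero_le) (Finset.mem_univ 0))

theorem theorem2 (n : ℕ) (hn : 1 ≤ n) :
    HasLowSNRExpansion (bicmCapacity n) 1 (-(1 / 2)) ∧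
    HasLowSNRExpansion (bicmCapacityCentered n) 1 (-(1 / 2)) ∧
    ∃ (p : Fin n ⊕ Fin n → PMF Bool) (c : ℝ), IsNormalized n p 0 c ∧
      (labelLaw n p).map (qamSymbol n 0 c) = uniformOn qpsk ∧
      HasLowSNRExpansion (bicmRate n p 0 c) 1 (-(1 / 2)) := by
  -- This exposes the leading bit of each component.
  obtain ⟨k, rfl⟩ : ∃ k, n = k + 1 := ⟨n - 1, by omega⟩
  obtain ⟨C, hC⟩ := exists_le_bicmRate_cornerBits k
  have hnorm := isNormalized_cornerBits k
  have hcentered : ∀ s, bicmRate (k + 1) (cornerBits k) 0 (cornerScale k) s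
      ≤ bicmCapacityCentered (k + 1) s := fun s =>
    le_iSup_of_le (cornerBits k) (le_iSup_of_le (cornerScale k) (le_iSup_of_le hnorm le_rfl))
  have hcapacity : ∀ s, bicmCapacityCentered (k + 1) s ≤ bicmCapacity (k + 1) s := fun s =>
    iSup_mono fun p => iSup_le fun c => le_iSup_of_le 0 (le_iSup_of_le c le_rfl)
  have hlog : ∀ s : ℝ, 0 < s → bicmCapacity (k + 1) s ≤ ENNReal.ofReal (Real.log (1 + s)) :=
    fun s hs => iSup_le fun p => iSup_le fun a => iSup_le fun c => iSup_le fun h =>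
      bicmRate_le_log _ p h hs
  refine ⟨hasLowSNRExpansion_of_bounds hlog fun s hs hs1 =>
      (hC s hs hs1).trans ((hcentered s).trans (hcapacity s)),
    hasLowSNRExpansion_of_bounds (fun s hs => (hcapacity s).trans (hlog s hs)) fun s hs hs1 =>
      (hC s hs hs1).trans (hcentered s),
    cornerBits k, cornerScale k, hnorm, labelLaw_cornerBits_map k,
    hasLowSNRExpansion_of_bounds (fun s hs => bicmRate_le_log _ _ hnorm hs) hC⟩
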